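/- All Banach spaces are real, Boolean algebras are nondegenerate ($0\neq 1$), and a compact space means a nonempty compact Hausdorff space. The density of a topological space is the least cardinality of a dense subset; its weight is the least cardinality of a base. For a Boolean algebra $A$, $K_A$ denotes its Stone space, i.e. the space of ultrafilters of $A$ (a compact totally disconnected space whose algebra of clopen subsets is isomorphic to $A$), and $C(K_A)$ is the Banach space of real-valued continuous functions on $K_A$ with the supremum norm. For an infinite cardinal $\kappa$ let $\mathcal B_\kappa$ be the class of Banach spaces of density at most $\kappa$, $\mathcal C_\kappa$ the class of compact spaces of weight at most $\kappa$, and $\mathcal A_\kappa$ the class of Boolean algebras of cardinality at most $\kappa$. A space $X\in\mathcal B_\kappa$ is isometrically universal for $\mathcal B_\kappa$ if for every $Y\in\mathcal B_\kappa$ there is a linear isometry of $Y$ onto a subspace of $X$; a space $K\in\mathcal C_\kappa$ is universal for $\mathcal C_\kappa$ if for every $L\in\mathcal C_\kappa$ there is a continuous surjection $K\to L$; an algebra $A\in\mathcal A_\kappa$ is universal for $\mathcal A_\kappa$ if for every $B\in\mathcal A_\kappa$ there is an injective Boolean homomorphism $B\to A$. Theorem. Let $\kappa$ be an uncountable cardinal.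 If there exists an isometrically universal Banach space for $\mathcal B_\kappa$, then there is a Boolean algebra $A\in\mathcal A_\kappa$ (so that $K_A\in\mathcal C_\kappa$) such that $C(K_A)$ is isometrically universal for $\mathcal B_\kappa$ and every subset of $A$ that is well-ordered by the order of $A$ is countable. In particular, $A$ is not universal for $\mathcal A_\kappa$, and $K_A$ is not universal for $\mathcal C_\kappa$. -/

import Mathlib

universe u

open scoped Cardinal

namespace UnivBanach

/-- The density (character) of a topological space: the least cardinality of a dense subset. -/
noncomputable def density (X : Type u) [TopologicalSpace X] : Cardinal.{u} :=
  sInf {c | ∃ D : Set X, Dense D ∧ #D = c}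

/-- The weight of a topological space: the least cardinality of a basis of open sets. -/
noncomputable def weight (X : Type u) [TopologicalSpace X] : Cardinal.{u} :=
  sInf {c | ∃ B : Set (Set X), TopologicalSpace.IsTopologicalBasis B ∧ #B = c}

/-- The Stone space of a Boolean algebra `A`. Its points are the ultrafilters of `A`, given by
their characteristic functions, that is, as the Boolean homomorphisms from `A` to the two-element
algebra. A homomorphism of bounded lattices between Boolean algebras preserves complements. -/
def StoneSpace (A : Type u) [BooleanAlgebra A] : Type u := BoundedLatticeHom A Bool

namespace StoneSpace

variable {A : Type u} [BooleanAlgebra A]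

/-- The value at `a` of the point `x`: it is `true` when `a` belongs to the ultrafilter `x`. -/
noncomputable def val (x : StoneSpace A) (a : A) : Bool := BoundedLatticeHom.toLatticeHom x a

/-- The topology of pointwise convergence, generated by the sets `{x | x.val a = true}`. -/
noncomputable instance : TopologicalSpace (StoneSpace A) :=
  TopologicalSpace.induced val inferInstance

theorem isEmbedding_val : Topology.IsEmbedding (val : StoneSpace A → A → Bool) where
  eq_induced := rfl
  injective := fun x y h => by
    apply DFunLike.coe_injective (F := BoundedLatticeHom A Bool)
    exact h

theorem range_val : Set.range (val : StoneSpace A → A → Bool) =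
    {f | f ⊤ = ⊤ ∧ f ⊥ = ⊥ ∧ ∀ a b, f (a ⊔ b) = f a ⊔ f b ∧ f (a ⊓ b) = f a ⊓ f b} := by
  ext f
  constructor
  · rintro ⟨x, rfl⟩
    exact ⟨x.map_top', x.map_bot', fun a b => ⟨x.map_sup' a b, x.map_inf' a b⟩⟩
  · rintro ⟨h1, h2, h3⟩
    exact ⟨({ toFun := f, map_sup' := fun a b => (h3 a b).1, map_inf' := fun a b => (h3 a b).2,
              map_top' := h1, map_bot' := h2 } : BoundedLatticeHom A Bool), rfl⟩

theorem isClosedEmbedding_val :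
    Topology.IsClosedEmbedding (val : StoneSpace A → A → Bool) where
  toIsEmbedding := isEmbedding_val
  isClosed_range := by
    rw [range_val]
    simp only [Set.ofPred_and, Set.ofPred_forall]
    refine (isClosed_eq (by fun_prop) (by fun_prop)).inter
      ((isClosed_eq (by fun_prop) (by fun_prop)).inter ?_)
    refine isClosed_iInter fun a => isClosed_iInter fun b => IsClosed.inter ?_ ?_
    · exact isClosed_eq (by fun_prop)
        ((continuous_of_discreteTopology (f := fun p : Bool × Bool => p.1 ⊔ p.2)).comp
          (by fun_prop : Continuous fun f : A → Bool => (f a, f b)))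
    · exact isClosed_eq (by fun_prop)
        ((continuous_of_discreteTopology (f := fun p : Bool × Bool => p.1 ⊓ p.2)).comp
          (by fun_prop : Continuous fun f : A → Bool => (f a, f b)))

instance : CompactSpace (StoneSpace A) := isClosedEmbedding_val.compactSpace

instance : T2Space (StoneSpace A) := isEmbedding_val.t2Space

instance : TotallyDisconnectedSpace (StoneSpace A) :=
  isEmbedding_val.isTotallyDisconnected_range.mp
    (isTotallyDisconnected_of_totallyDisconnectedSpace _)

end StoneSpace

/-- `X` is a Banach space of density at most `κ` that is isometrically universal for the class of
all (real) Banach spaces of density at most `κ`. -/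
def IsUniversalBanachSpace (κ : Cardinal.{u}) (X : Type u) [NormedAddCommGroup X]
    [NormedSpace ℝ X] [CompleteSpace X] : Prop :=
  density X ≤ κ ∧
    ∀ (Y : Type u) [NormedAddCommGroup Y] [NormedSpace ℝ Y] [CompleteSpace Y],
      density Y ≤ κ → Nonempty (Y →ₗᵢ[ℝ] X)

/-- `A` is a Boolean algebra of cardinality at most `κ` that is universal for the class of all
nondegenerate (`⊥ ≠ ⊤`) Boolean algebras of cardinality at most `κ`: each of them is isomorphic
to a subalgebra of `A`. -/
def IsUniversalBooleanAlgebra (κ : Cardinal.{u}) (A : Type u) [BooleanAlgebra A] : Prop :=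
  #A ≤ κ ∧
    ∀ (B : Type u) [BooleanAlgebra B] [Nontrivial B],
      #B ≤ κ → ∃ h : BoundedLatticeHom B A, Function.Injective h

/-- `K` is a compact Hausdorff space of weight at most `κ` that is universal for the class of all
nonempty compact Hausdorff spaces of weight at most `κ`: it maps continuously onto each of
them. -/
def IsUniversalCompactSpace (κ : Cardinal.{u}) (K : Type u) [TopologicalSpace K]
    [CompactSpace K] [T2Space K] : Prop :=
  weight K ≤ κ ∧
    ∀ (L : Type u) [TopologicalSpace L] [CompactSpace L] [T2Space L] [Nonempty L],
      weight L ≤ κ → ∃ φ : K → L, Continuous φ ∧ Function.Surjective φ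

/-- Every well-ordered chain in `A` is countable. -/
def NoUncountableWellOrderedChain (A : Type u) [BooleanAlgebra A] : Prop :=
  ∀ S : Set A, IsChain (· ≤ ·) S → S.IsWF → S.Countable

end UnivBanach

/-!
Let `X` be universal for the Banach spaces of density at most `κ`, let `L` be the dual unit ball of
`X` with the weak* topology, and let `D` be a dense subset of `X` of cardinality at most `κ`. For
`d ∈ D` and rational `p < q`, the closed half-spaces `{φ | p ≤ φ d}` and `{φ | φ d ≤ q}` cover `L`.
Let `K` be the space of pairs `(φ, σ)`, where `φ ∈ L` and `σ` chooses freely, for each `(d, p, q)`,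
one of the two half-spaces containing `φ` (`selectionSpace`). It is compact, it maps onto `L`, and
`σ` determines `φ`, so `K` is the Stone space of the algebra `A` of its subsets that are determined
by finitely many coordinates of `σ`. By the Hahn–Banach theorem `X` embeds isometrically in `C(K)`.

The algebra `A` has no well-ordered chain `(U_α)` of type `ω₁`. One may assume that the finite
supports of the `U_α` meet only in a finite root `R`, up to countably many exceptions for each of
them (`exists_root`). Over a fixed `φ` the choices are independent, so whether `(φ, σ)` lies in
`U = ⋃ U_α` depends only on the restriction of `σ` to `R` (`eventually_mem_of_agree_on_root`). For a
given pattern on `R`, the compatible `φ ∈ L` form a convex set. On a segment in it, `U` is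
sequentially closed, being a union of closed sets of which any countably many are contained in a
single one; the complement of `U` is an intersection of closed sets. So by connectedness `U`
contains everything over the segment or nothing (`exists_mem_of_agree_on_root`). Therefore `U` is a
clopen set determined by `R`, and by compactness the chain stabilizes.

An algebra of cardinality `ℵ₁` with a chain of type `ω₁` cannot embed in `A`, and by compactness its
Stone space cannot be a continuous image of `K`.
-/

open scoped Cardinal

/-! ### Stone spaces -/

namespace UnivBanach

open Topology TopologicalSpace

namespace StoneSpace

variable {A : Type u} [BooleanAlgebra A]

theorem val_top (x : StoneSpace A) : x.val ⊤ = true := x.map_top'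

theorem val_bot (x : StoneSpace A) : x.val ⊥ = false := x.map_bot'

theorem val_sup (x : StoneSpace A) (a b : A) : x.val (a ⊔ b) = (x.val a || x.val b) :=
  x.map_sup' a b

theorem val_inf (x : StoneSpace A) (a b : A) : x.val (a ⊓ b) = (x.val a && x.val b) :=
  x.map_inf' a b

theorem val_compl (x : StoneSpace A) (a : A) : x.val aᶜ = !x.val a := by
  have h1 := x.val_sup a aᶜ
  have h2 := x.val_inf a aᶜ
  rw [sup_compl_eq_top, val_top] at h1
  rw [inf_compl_eq_bot, val_bot] at h2
  revert h1 h2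
  cases x.val a <;> cases x.val aᶜ <;> simp

theorem continuous_val (a : A) : Continuous fun x : StoneSpace A => x.val a :=
  (continuous_apply a).comp isEmbedding_val.continuous

theorem isClopen_setOf_val (a : A) : IsClopen {x : StoneSpace A | x.val a = true} :=
  (isClopen_discrete {true}).preimage (continuous_val a)

theorem isTopologicalBasis_range :
    IsTopologicalBasis (Set.range fun a : A => {x : StoneSpace A | x.val a = true}) := by
  classical
  refine isTopologicalBasis_of_isOpen_of_nhds ?_ ?_
  · rintro _ ⟨a, rfl⟩
    exact (isClopen_setOf_val a).isOpen
  · intro x U hx hU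
    obtain ⟨V, hV, rfl⟩ := isOpen_induced_iff.1 hU
    obtain ⟨I, u, hu, hIu⟩ := isOpen_pi_iff.1 hV _ hx
    have key : ∀ I : Finset A, ∃ a, x.val a = true ∧
        ∀ y : StoneSpace A, y.val a = true → ∀ i ∈ I, y.val i = x.val i := by
      intro I
      induction I using Finset.induction_on with
      | empty => exact ⟨⊤, x.val_top, by simp⟩
      | insert i I _ ih =>
        obtain ⟨a, ha, hay⟩ := ih
        refine ⟨a ⊓ (if x.val i = true then i else iᶜ), ?_, ?_⟩
        · split_ifs with h <;> simp [val_inf, val_compl, ha, h]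
        · intro y hy j hj
          rw [val_inf, Bool.and_eq_true] at hy
          rcases Finset.mem_insert.1 hj with rfl | hj
          · have := hy.2
            split_ifs at this with h
            · rw [this, h]
            · rw [val_compl] at this
              simp_all
          · exact hay y hy.1 j hj
    obtain ⟨a, ha, hay⟩ := key I
    refine ⟨_, ⟨a, rfl⟩, ha, fun y hy => hIu fun i hi => ?_⟩
    rw [hay y hy i hi]
    exact (hu i hi).2

/-- By compactness, every clopen subset of the Stone space of `A` comes from an element of `A`. -/
theorem exists_eq_setOf_val {U : Set (StoneSpace A)} (hU : IsClopen U) :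
    ∃ a : A, U = {x | x.val a = true} := by
  obtain ⟨s, hs, rfl⟩ := (isCompact_open_iff_eq_finite_iUnion_of_isTopologicalBasis
    (fun a : A => {x : StoneSpace A | x.val a = true}) isTopologicalBasis_range
    (fun a => (isClopen_setOf_val a).isClosed.isCompact) U).1
    ⟨hU.isClosed.isCompact, hU.isOpen⟩
  clear hU
  induction s, hs using Set.Finite.induction_on with
  | empty => exact ⟨⊥, by simp [val_bot]⟩
  | @insert a _ _ _ ih =>
    obtain ⟨b, hb⟩ := ih
    refine ⟨a ⊔ b, ?_⟩
    rw [Set.biUnion_insert, hb]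
    ext x
    simp [val_sup]

theorem weight_le : weight (StoneSpace A) ≤ #A :=
  (csInf_le' (Set.mem_ofPred.2 ⟨_, isTopologicalBasis_range, rfl⟩)).trans Cardinal.mk_range_le

/-- The indicator function of the clopen set of ultrafilters containing `a`. -/
noncomputable def indicator (a : A) : C(StoneSpace A, ℝ) where
  toFun x := if x.val a = true then 1 else 0
  continuous_toFun :=
    (continuous_of_discreteTopology (f := fun b : Bool => if b = true then (1 : ℝ) else 0)).comp
      (continuous_val a)

theorem indicator_apply (a : A) (x : StoneSpace A) :
    indicator a x = if x.val a = true then 1 else 0 := rfl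

/-- The rational linear combinations of indicator functions are dense in `C(StoneSpace A, ℝ)`. -/
theorem dense_span_indicator :
    Dense (Submodule.span ℚ (Set.range (indicator (A := A))) : Set C(StoneSpace A, ℝ)) := by
  set M := Submodule.span ℚ (Set.range (indicator (A := A)))
  -- The closure of the rational span is closed under multiplication by real scalars.
  have hsmul : ∀ (c : ℝ), ∀ f ∈ closure (M : Set C(StoneSpace A, ℝ)),
      c • f ∈ closure (M : Set C(StoneSpace A, ℝ)) := by
    intro c f hf
    refine Rat.isDenseEmbedding_coe_real.dense.induction_on
      (p := fun c : ℝ => c • f ∈ closure (M : Set C(StoneSpace A, ℝ))) c ?_ ?_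
    · exact isClosed_closure.preimage (by fun_prop : Continuous fun c : ℝ => c • f)
    · intro q
      refine map_mem_closure (by fun_prop : Continuous fun f : C(StoneSpace A, ℝ) => (q : ℝ) • f)
        hf fun g hg => ?_
      have : (q : ℝ) • g = q • g := by
        ext x
        simp [Rat.smul_def]
      rw [this]
      exact M.smul_mem q hg
  have hspan : (Submodule.span ℝ (Set.range (indicator (A := A))) : Set C(StoneSpace A, ℝ)) ⊆
      closure (M : Set C(StoneSpace A, ℝ)) := by
    intro f hf
    induction hf using Submodule.span_induction with
    | mem f hf => exact subset_closure (Submodule.subset_span hf)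
    | zero => exact subset_closure M.zero_mem
    | add f g _ _ hf hg =>
      exact map_mem_closure₂ continuous_add hf hg fun a ha b hb => M.add_mem ha hb
    | smul c f _ hf => exact hsmul c f hf
  -- The indicator functions form a multiplicative monoid, so Stone–Weierstrass applies.
  have hmon : (Submonoid.closure (Set.range (indicator (A := A))) : Set C(StoneSpace A, ℝ)) ⊆
      Set.range (indicator (A := A)) := by
    intro f hf
    induction hf using Submonoid.closure_induction with
    | mem f hf => exact hf
    | one => exact ⟨⊤, by ext x; simp [indicator_apply, val_top]⟩
    | mul f g _ _ hf hg =>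
      obtain ⟨a, rfl⟩ := hf
      obtain ⟨b, rfl⟩ := hg
      refine ⟨a ⊓ b, ?_⟩
      ext x
      cases h : x.val a <;> simp [indicator_apply, val_inf, h]
  have hadj := Algebra.adjoin_eq_span_of_subset (R := ℝ) (hmon.trans Submodule.subset_span)
  have hsw := ContinuousMap.subalgebra_topologicalClosure_eq_top_of_separatesPoints
    (Algebra.adjoin ℝ (Set.range (indicator (A := A)))) (by
      intro x y hxy
      obtain ⟨a, ha⟩ := Function.ne_iff.1 (isEmbedding_val.injective.ne hxy)
      refine ⟨indicator a, ⟨indicator a, Algebra.subset_adjoin ⟨a, rfl⟩, rfl⟩, ?_⟩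
      revert ha
      cases h : x.val a <;> cases h' : y.val a <;> simp [indicator_apply, h, h'])
  intro f
  have hf : f ∈ (Algebra.adjoin ℝ (Set.range (indicator (A := A)))).topologicalClosure := by
    rw [hsw]
    trivial
  refine closure_minimal hspan isClosed_closure ?_
  rw [← hadj]
  exact hf

theorem density_continuousMap_le : density C(StoneSpace A, ℝ) ≤ max #A ℵ₀ := by
  refine (csInf_le' (Set.mem_ofPred.2 ⟨_, dense_span_indicator, rfl⟩)).trans ?_
  rw [← Finsupp.range_linearCombination]
  have : Nonempty A := ⟨⊤⟩
  refine Cardinal.mk_range_le.trans ?_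
  rw [Cardinal.mk_finsupp_lift_of_infinite']
  simp

end StoneSpace

/-! ### Algebras of sets determined by finitely many coordinates -/

section Determined

variable {K J : Type u}

/-- The Boolean algebra of the subsets of `K` for which membership of `x` depends only on finitely
many coordinates of `v x`. -/
def determinedSets (v : K → J → Bool) : BooleanSubalgebra (Set K) where
  carrier := {S | ∃ F : Finset J, ∀ x y, (∀ j ∈ F, v x j = v y j) → (x ∈ S ↔ y ∈ S)}
  supClosed' := by
    classical
    rintro S ⟨F, hF⟩ T ⟨G, hG⟩
    refine ⟨F ∪ G, fun x y h => ?_⟩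
    have h1 := hF x y fun j hj => h j (Finset.mem_union_left _ hj)
    have h2 := hG x y fun j hj => h j (Finset.mem_union_right _ hj)
    exact or_congr h1 h2
  infClosed' := by
    classical
    rintro S ⟨F, hF⟩ T ⟨G, hG⟩
    refine ⟨F ∪ G, fun x y h => ?_⟩
    have h1 := hF x y fun j hj => h j (Finset.mem_union_left _ hj)
    have h2 := hG x y fun j hj => h j (Finset.mem_union_right _ hj)
    exact and_congr h1 h2
  compl_mem' := by
    rintro S ⟨F, hF⟩
    exact ⟨F, fun x y h => not_congr (hF x y h)⟩
  bot_mem' := ⟨∅, fun _ _ _ => Iff.rfl⟩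

theorem setOf_apply_mem_determinedSets (v : K → J → Bool) (j : J) :
    {x | v x j = true} ∈ determinedSets v :=
  ⟨{j}, fun x y h => by simp [h j (Finset.mem_singleton_self j)]⟩

theorem mk_determinedSets_le (v : K → J → Bool) : #(determinedSets v) ≤ max #J ℵ₀ := by
  classical
  -- A determined set is coded by a finite set of coordinates and a set of patterns on it.
  let f : (Σ F : Finset J, Set (F → Bool)) → Set K := fun p => {x | (fun j : p.1 => v x j) ∈ p.2}
  have hf : (determinedSets v : Set (Set K)) ⊆ Set.range f := by
    rintro S ⟨F, hF⟩
    refine ⟨⟨F, {t | ∃ y ∈ S, ∀ j : F, t j = v y j}⟩, ?_⟩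
    ext x
    constructor
    · rintro ⟨y, hy, h⟩
      exact (hF x y fun j hj => h ⟨j, hj⟩).2 hy
    · intro hx
      exact ⟨x, hx, fun _ => rfl⟩
  refine (Cardinal.mk_le_mk_of_subset hf).trans (Cardinal.mk_range_le.trans ?_)
  rw [Cardinal.mk_sigma]
  refine (Cardinal.sum_le_sum _ (fun _ => ℵ₀) fun F => (Cardinal.lt_aleph0_of_finite _).le).trans ?_
  rw [Cardinal.sum_const']
  have h1 : #(Finset J) ≤ max #J ℵ₀ := by
    cases finite_or_infinite J
    · exact (Cardinal.lt_aleph0_of_finite _).le.trans (le_max_right _ _)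
    · rw [Cardinal.mk_finset_of_infinite]
      exact le_max_left _ _
  exact (mul_le_mul' h1 (le_max_right _ _)).trans (Cardinal.mul_eq_self (le_max_right _ _)).le

theorem isClopen_of_mem_determinedSets [TopologicalSpace K] {v : K → J → Bool}
    (hv : Continuous v) {S : Set K} (hS : S ∈ determinedSets v) : IsClopen S := by
  have hopen : ∀ S ∈ determinedSets v, IsOpen S := by
    rintro S ⟨F, hF⟩
    refine isOpen_iff_mem_nhds.2 fun x hx => ?_
    have : ∀ᶠ y in 𝓝 x, ∀ j ∈ F, v x j = v y j := by
      refine (Filter.eventually_all_finset F).2 fun j _ => ?_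
      have hj : Continuous fun y => v y j := (continuous_apply j).comp hv
      filter_upwards [hj.continuousAt.preimage_mem_nhds
        ((isOpen_discrete {v x j}).mem_nhds rfl)] with y hy using Eq.symm hy
    filter_upwards [this] with y hy using (hF x y hy).1 hx
  exact ⟨⟨hopen _ (BooleanSubalgebra.compl_mem hS)⟩, hopen _ hS⟩

open Classical in
/-- The principal ultrafilter of a field of sets at a point. -/
noncomputable def pointUltrafilter (B : BooleanSubalgebra (Set K)) (k : K) : StoneSpace B :=
  ({ toFun := fun S => decide (k ∈ (S : Set K))
     map_sup' := fun S T => by simp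
     map_inf' := fun S T => by simp
     map_top' := by simp
     map_bot' := by simp } : BoundedLatticeHom B Bool)

theorem val_pointUltrafilter (B : BooleanSubalgebra (Set K)) (k : K) (S : B) :
    (pointUltrafilter B k).val S = true ↔ k ∈ (S : Set K) := by
  classical exact decide_eq_true_iff

/-- If `K` is compact and the coordinates are continuous and separate points, every ultrafilter of
determined sets is principal. -/
theorem exists_homeomorph_stoneSpace [TopologicalSpace K] [CompactSpace K] {v : K → J → Bool}
    (hv : Continuous v) (hinj : Function.Injective v) :
    Nonempty (StoneSpace (determinedSets v) ≃ₜ K) := by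
  let e : K → StoneSpace (determinedSets v) := pointUltrafilter _
  have he : Continuous e := by
    refine continuous_induced_rng.2 (continuous_pi fun S => ?_)
    refine (continuous_bool_rng true).2 ?_
    convert isClopen_of_mem_determinedSets hv S.2 using 1
    ext k
    exact val_pointUltrafilter _ k S
  have hei : Function.Injective e := by
    intro k l h
    refine hinj (funext fun j => ?_)
    have h1 := val_pointUltrafilter _ k ⟨_, setOf_apply_mem_determinedSets v j⟩
    have h2 := val_pointUltrafilter _ l ⟨_, setOf_apply_mem_determinedSets v j⟩
    change (e k).val _ = _ ↔ _ at h1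
    rw [h] at h1
    exact Bool.eq_iff_iff.2 (h1.symm.trans h2)
  have hes : Function.Surjective e := by
    have hd : DenseRange e := by
      refine StoneSpace.isTopologicalBasis_range.dense_iff.2 ?_
      rintro _ ⟨S, rfl⟩ ⟨x, hx⟩
      have hne : (S : Set K).Nonempty := by
        rw [Set.nonempty_iff_ne_empty]
        intro h
        have : S = ⊥ := Subtype.ext h
        subst this
        have hx : x.val ⊥ = true := hx
        simp [StoneSpace.val_bot] at hx
      obtain ⟨k, hk⟩ := hne
      exact ⟨e k, (val_pointUltrafilter _ k S).2 hk, k, rfl⟩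
    exact Set.range_eq_univ.1
      ((isCompact_range he).isClosed.closure_eq.symm.trans hd.closure_eq)
  exact ⟨(he.homeoOfEquivCompactToT2 (f := Equiv.ofBijective e ⟨hei, hes⟩)).symm⟩

end Determined

/-! ### Well-ordered chains of clopen sets -/

section Chains

instance {ι : Type*} [Uncountable ι] : (Filter.cocountable : Filter ι).NeBot := by
  rw [← Filter.empty_mem_iff_bot.not.trans Filter.neBot_iff.symm, Filter.mem_cocountable,
    Set.compl_empty]
  exact Set.not_countable_univ

instance {ι : Type*} : CountableInterFilter (Filter.cocountable : Filter ι) :=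
  CardinalInterFilter.toCountableInterFilter _ Cardinal.aleph0_lt_aleph_one

theorem compl_mem_cocountable {ι : Type*} {s : Set ι} (hs : s.Countable) :
    sᶜ ∈ (Filter.cocountable : Filter ι) := by
  rwa [Filter.mem_cocountable, compl_compl]

variable {E J : Type u}

/-- The compact space of the pairs `(x, σ)`, where `x ∈ L` and `σ` selects, for each index `j`,
one of the two sets `C j true`, `C j false` that contains `x`. -/
def selectionSpace (L : Set E) (C : J → Bool → Set E) : Set (E × (J → Bool)) :=
  {p | p.1 ∈ L ∧ ∀ j, p.1 ∈ C j (p.2 j)}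

theorem isClosed_setOf_forall_mem [TopologicalSpace E] {C : J → Bool → Set E}
    (hC : ∀ j b, IsClosed (C j b)) :
    IsClosed {p : E × (J → Bool) | ∀ j, p.1 ∈ C j (p.2 j)} := by
  simp only [Set.ofPred_forall]
  refine isClosed_iInter fun j => ?_
  have : {p : E × (J → Bool) | p.1 ∈ C j (p.2 j)} =
      ⋃ b : Bool, {p | p.2 j = b} ∩ {p | p.1 ∈ C j b} := by
    ext p
    simp
  rw [this]
  refine isClosed_iUnion_of_finite fun b => IsClosed.inter ?_ ?_
  · exact isClosed_eq (by fun_prop) (by fun_prop)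
  · exact (hC j b).preimage continuous_fst

theorem isCompact_selectionSpace [TopologicalSpace E] {L : Set E} {C : J → Bool → Set E}
    (hL : IsCompact L) (hC : ∀ j b, IsClosed (C j b)) : IsCompact (selectionSpace L C) := by
  have : selectionSpace L C =
      L ×ˢ Set.univ ∩ {p : E × (J → Bool) | ∀ j, p.1 ∈ C j (p.2 j)} := by
    ext p
    simp [selectionSpace]
  rw [this]
  exact (hL.prod isCompact_univ).inter_right (isClosed_setOf_forall_mem hC)

theorem isClopen_of_forall_finset {W : Set (J → Bool)} {F : Finset J}
    (h : ∀ σ τ : J → Bool, (∀ j ∈ F, σ j = τ j) → σ ∈ W → τ ∈ W) : IsClopen W := by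
  refine isClopen_of_mem_determinedSets (v := fun σ : J → Bool => σ) continuous_id
    ⟨F, fun σ τ hστ => ⟨h σ τ hστ, h τ σ fun j hj => (hστ j hj).symm⟩⟩

variable {ι : Type*} {L : Set E} {C : J → Bool → Set E} {W : ι → Set (J → Bool)}
  {F : ι → Finset J} {R : Finset J}

/-- In this and the next two lemmas, `W α` is a clopen set of the Cantor cube with finite support
`F α`, and the traces of these sets on the selection space form a chain of type `ω₁`. What is used
of the order is that each trace is contained in all but countably many others. An index outside the
root `R` belongs to only countably many supports. Within a fibre of the selection space, the union of the
chain then depends only on the coordinates in `R`: two supports that meet only in `R` allow a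
move from one point of the fibre to another. -/
theorem eventually_mem_of_agree_on_root
    (hW : ∀ α σ τ, (∀ j ∈ F α, σ j = τ j) → σ ∈ W α → τ ∈ W α)
    (hmono : ∀ α, ∀ᶠ γ in Filter.cocountable, ∀ p ∈ selectionSpace L C,
      p.2 ∈ W α → p.2 ∈ W γ)
    (hR : ∀ j ∉ R, ∀ᶠ γ in Filter.cocountable, j ∉ F γ) (α : ι) :
    ∀ᶠ γ in Filter.cocountable, ∀ x σ τ, (x, σ) ∈ selectionSpace L C →
      (x, τ) ∈ selectionSpace L C → (∀ j ∈ R, σ j = τ j) → σ ∈ W α → τ ∈ W γ := by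
  classical
  have hF : ∀ᶠ γ in Filter.cocountable, ∀ j ∈ F α, j ∉ R → j ∉ F γ := by
    refine (Filter.eventually_all_finset _).2 fun j _ => ?_
    by_cases hj : j ∈ R
    · exact .of_forall fun γ h => absurd hj h
    · filter_upwards [hR j hj] with γ hγ _ using hγ
  filter_upwards [hF, hmono α] with γ hγ hγα x σ τ hσ hτ hRστ hσα
  -- The point `ρ` follows `σ` on the support of index `α` and `τ` elsewhere.
  let ρ : J → Bool := fun j => if j ∈ F α then σ j else τ j
  have hρ : (x, ρ) ∈ selectionSpace L C := by
    refine ⟨hσ.1, fun j => ?_⟩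
    by_cases h : j ∈ F α
    · simpa [ρ, h] using hσ.2 j
    · simpa [ρ, h] using hτ.2 j
  have hρα : ρ ∈ W α := hW α σ ρ (fun j hj => by simp [ρ, hj]) hσα
  refine hW γ ρ τ (fun j hj => ?_) (hγα _ hρ hρα)
  by_cases h : j ∈ F α
  · have : j ∈ R := by
      by_contra hjR
      exact hγ j h hjR hj
    simp [ρ, h, hRστ j this]
  · simp [ρ, h]

variable [AddCommGroup E] [Module ℝ E] [TopologicalSpace E] [ContinuousAdd E]
  [ContinuousSMul ℝ E]

/-- The union of the chain depends only on the coordinates in the root. The points of `L`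
compatible with a given pattern on the root form a convex set; along a segment in this set, both
the union of the chain and its complement are closed, so that connectedness of the segment
decides between nothing and everything. -/
theorem exists_mem_of_agree_on_root [Uncountable ι] (hLconv : Convex ℝ L)
    (hC : ∀ j b, IsClosed (C j b)) (hCconv : ∀ j b, Convex ℝ (C j b))
    (hcover : ∀ x ∈ L, ∀ j, ∃ b, x ∈ C j b)
    (hW : ∀ α σ τ, (∀ j ∈ F α, σ j = τ j) → σ ∈ W α → τ ∈ W α)
    (hmono : ∀ α, ∀ᶠ γ in Filter.cocountable, ∀ p ∈ selectionSpace L C,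
      p.2 ∈ W α → p.2 ∈ W γ)
    (hR : ∀ j ∉ R, ∀ᶠ γ in Filter.cocountable, j ∉ F γ)
    {p q : E × (J → Bool)} (hp : p ∈ selectionSpace L C) (hq : q ∈ selectionSpace L C)
    (hpq : ∀ j ∈ R, p.2 j = q.2 j) {α : ι} (hpα : p.2 ∈ W α) : ∃ γ, q.2 ∈ W γ := by
  classical
  have hfib := eventually_mem_of_agree_on_root hW hmono hR
  obtain ⟨x, σ⟩ := p
  obtain ⟨y, τ⟩ := q
  let g : unitInterval → E := fun t => AffineMap.lineMap x y (t : ℝ)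
  have hg : Continuous g := by
    simp only [g, AffineMap.lineMap_apply_module]
    fun_prop
  have hgL : ∀ t, g t ∈ L := fun t =>
    hLconv.segment_subset hp.1 hq.1 (by
      rw [segment_eq_image_lineMap]; exact ⟨t, t.2, rfl⟩)
  have hgC : ∀ t, ∀ j ∈ R, g t ∈ C j (σ j) := fun t j hj =>
    (hCconv j (σ j)).segment_subset (hp.2 j)
      ((hpq j hj : σ j = τ j) ▸ hq.2 j) (by
      rw [segment_eq_image_lineMap]; exact ⟨t, t.2, rfl⟩)
  -- `D V` is the set of parameters over which some selection extending `σ` on `R` lies in `V`.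
  let D : Set (J → Bool) → Set unitInterval := fun V =>
    Prod.fst '' {p : unitInterval × (J → Bool) |
      (∀ j, g p.1 ∈ C j (p.2 j)) ∧ (∀ j ∈ R, σ j = p.2 j) ∧ p.2 ∈ V}
  have hD : ∀ V : Set (J → Bool), IsClosed V → IsClosed (D V) := by
    intro V hV
    refine (IsClosed.isCompact ?_).image continuous_fst |>.isClosed
    simp only [Set.ofPred_and, Set.ofPred_forall]
    refine IsClosed.inter ?_ (IsClosed.inter ?_ (hV.preimage continuous_snd))
    · have := (isClosed_setOf_forall_mem hC).preimage
        (f := fun p : unitInterval × (J → Bool) => (g p.1, p.2)) (by fun_prop)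
      convert this using 1
      ext p
      simp
    · exact isClosed_iInter fun j => isClosed_iInter fun _ =>
        isClosed_eq continuous_const (by fun_prop)
  have hWc : ∀ α, IsClopen (W α) := fun α => isClopen_of_forall_finset (hW α)
  let M : Set unitInterval := ⋃ α, D (W α)
  -- The union of the chain is sequentially closed, since countably many indices are dominated.
  have hM : IsClosed M := by
    refine IsSeqClosed.isClosed fun t s ht hts => ?_
    choose a ha using fun n => Set.mem_iUnion.1 (ht n)
    obtain ⟨γ, hγ⟩ := (eventually_countable_forall.2 fun n => hmono (a n)).exists
    refine Set.mem_iUnion.2 ⟨γ, (hD _ (hWc γ).isClosed).mem_of_tendsto hts (.of_forall ?_)⟩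
    intro n
    obtain ⟨⟨_, ρ⟩, ⟨h1, h2, h3⟩, rfl⟩ := ha n
    exact ⟨(_, ρ), ⟨h1, h2, hγ n (_, ρ) ⟨hgL _, h1⟩ h3⟩, rfl⟩
  have hMc : Mᶜ = ⋂ α, D (W α)ᶜ := by
    ext t
    constructor
    · intro ht
      choose b hb using hcover (g t) (hgL t)
      let ρ : J → Bool := fun j => if j ∈ R then σ j else b j
      have hρ : ∀ j, g t ∈ C j (ρ j) := by
        intro j
        by_cases h : j ∈ R
        · simpa [ρ, h] using hgC t j h
        · simpa [ρ, h] using hb j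
      have hρR : ∀ j ∈ R, σ j = ρ j := fun j hj => by simp [ρ, hj]
      refine Set.mem_iInter.2 fun β => ⟨(t, ρ), ⟨hρ, hρR, fun hβ => ht ?_⟩, rfl⟩
      exact Set.mem_iUnion.2 ⟨β, (t, ρ), ⟨hρ, hρR, hβ⟩, rfl⟩
    · intro ht htM
      obtain ⟨β, ⟨_, ρ⟩, ⟨h1, h2, h3⟩, rfl⟩ := Set.mem_iUnion.1 htM
      obtain ⟨γ, hγ⟩ := (hfib β).exists
      obtain ⟨⟨s, ρ'⟩, ⟨h1', h2', h3'⟩, hs⟩ := Set.mem_iInter.1 ht γ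
      obtain rfl : s = _ := hs
      exact h3' (hγ _ ρ ρ' ⟨hgL _, h1⟩ ⟨hgL _, h1'⟩
        (fun j hj => (h2 j hj).symm.trans (h2' j hj)) h3)
  have hMo : IsOpen M := by
    rw [← isClosed_compl_iff, hMc]
    exact isClosed_iInter fun α => hD _ (hWc α).compl.isClosed
  have hMuniv : M = Set.univ := by
    refine IsClopen.eq_univ ⟨hM, hMo⟩ ⟨0, Set.mem_iUnion.2 ⟨α, (0, σ), ⟨?_, ?_, hpα⟩, rfl⟩⟩
    · simpa [g] using hp.2
    · exact fun _ _ => rfl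
  have h1 : (1 : unitInterval) ∈ M := hMuniv ▸ Set.mem_univ _
  obtain ⟨β, ⟨s, ρ⟩, ⟨h1, h2, h3⟩, hs⟩ := Set.mem_iUnion.1 h1
  obtain rfl : s = 1 := hs
  obtain ⟨γ, hγ⟩ := (hfib β).exists
  refine ⟨γ, hγ y ρ τ ⟨hq.1, ?_⟩ hq (fun j hj => (h2 j hj).symm.trans (hpq j hj)) h3⟩
  simpa [g] using h1

/-- Under the same hypotheses, the family of clopen sets has a largest member: its union is
determined by the root, hence compact. -/
theorem exists_forall_subset_of_chain [Uncountable ι] (hL : IsCompact L) (hLconv : Convex ℝ L)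
    (hC : ∀ j b, IsClosed (C j b)) (hCconv : ∀ j b, Convex ℝ (C j b))
    (hcover : ∀ x ∈ L, ∀ j, ∃ b, x ∈ C j b)
    (hW : ∀ α σ τ, (∀ j ∈ F α, σ j = τ j) → σ ∈ W α → τ ∈ W α)
    (hmono : ∀ α, ∀ᶠ γ in Filter.cocountable, ∀ p ∈ selectionSpace L C,
      p.2 ∈ W α → p.2 ∈ W γ)
    (hR : ∀ j ∉ R, ∀ᶠ γ in Filter.cocountable, j ∉ F γ) :
    ∃ γ, ∀ β, ∀ p ∈ selectionSpace L C, p.2 ∈ W β → p.2 ∈ W γ := by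
  let Z : Set (J → Bool) :=
    {σ | ∃ p ∈ selectionSpace L C, (∃ α, p.2 ∈ W α) ∧ ∀ j ∈ R, p.2 j = σ j}
  have hZ : IsClopen Z := isClopen_of_forall_finset (F := R) fun σ τ h ⟨p, hp, hα, hpσ⟩ =>
    ⟨p, hp, hα, fun j hj => (hpσ j hj).trans (h j hj)⟩
  have hcomp : IsCompact (selectionSpace L C ∩ {p | p.2 ∈ Z}) :=
    (isCompact_selectionSpace hL hC).inter_right (hZ.isClosed.preimage continuous_snd)
  obtain ⟨t, ht⟩ := hcomp.elim_finite_subcover (fun α => {p : E × (J → Bool) | p.2 ∈ W α})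
    (fun α => (isClopen_of_forall_finset (hW α)).isOpen.preimage continuous_snd) (by
      rintro q ⟨hq, p, hp, ⟨α, hα⟩, hpq⟩
      obtain ⟨γ, hγ⟩ :=
        exists_mem_of_agree_on_root hLconv hC hCconv hcover hW hmono hR hp hq hpq hα
      exact Set.mem_iUnion.2 ⟨γ, hγ⟩)
  obtain ⟨γ, hγ⟩ := ((Filter.eventually_all_finset t).2 fun α _ => hmono α).exists
  refine ⟨γ, fun β p hp hβ => ?_⟩
  obtain ⟨α, hαt, hα⟩ := Set.mem_iUnion₂.1 (ht ⟨hp, p, hp, ⟨β, hβ⟩, fun _ _ => rfl⟩)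
  exact hγ α hαt p hp hα

end Chains

/-- A weak form of the `Δ`-system lemma: an uncountable family of finite sets has an uncountable
subfamily with a finite root such that every point outside the root lies in only countably many
members. -/
theorem exists_root {α J : Type*} [DecidableEq J] {T : Set α} (hT : ¬ T.Countable)
    (F : α → Finset J) :
    ∃ T' ⊆ T, ¬ T'.Countable ∧ ∃ R : Finset J, ∀ j ∉ R, {s ∈ T' | j ∈ F s}.Countable := by
  obtain ⟨n, hn⟩ : ∃ n, ¬ {s ∈ T | (F s).card = n}.Countable := by
    by_contra! h
    refine hT ((Set.countable_iUnion h).mono fun s hs => ?_)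
    exact Set.mem_iUnion.2 ⟨(F s).card, hs, rfl⟩
  -- A root of the largest possible size.
  let P : ℕ → Prop := fun m => ∃ R : Finset J, R.card = m ∧
    ¬ {s ∈ T | (F s).card = n ∧ R ⊆ F s}.Countable
  have hP0 : P 0 := ⟨∅, rfl, by simpa using hn⟩
  have hPn : ∀ m, P m → m ≤ n := by
    rintro m ⟨R, rfl, hR⟩
    obtain ⟨s, hs⟩ : {s ∈ T | (F s).card = n ∧ R ⊆ F s}.Nonempty := by
      rw [Set.nonempty_iff_ne_empty]
      intro h
      exact hR (h ▸ Set.countable_empty)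
    exact (Finset.card_le_card hs.2.2).trans_eq hs.2.1
  classical
  obtain ⟨R, hRc, hR⟩ := Nat.findGreatest_spec (P := P) (Nat.zero_le n) hP0
  refine ⟨_, fun s hs => hs.1, hR, R, fun j hj => ?_⟩
  by_contra hcount
  have : P (Nat.findGreatest P n + 1) := by
    refine ⟨insert j R, by rw [Finset.card_insert_of_notMem hj, hRc], fun h => hcount (h.mono ?_)⟩
    rintro s ⟨⟨hs, hsn, hRs⟩, hjs⟩
    exact ⟨hs, hsn, Finset.insert_subset hjs hRs⟩
  have := Nat.le_findGreatest (hPn _ this) this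
  omega

/-- For a compact convex set covered by pairs of closed convex sets, the algebra of the subsets of
the selection space that depend on finitely many selections has no uncountable well-ordered
chain. -/
theorem noUncountableWellOrderedChain_selectionSpace {E J : Type u} {L : Set E}
    {C : J → Bool → Set E} [AddCommGroup E] [Module ℝ E] [TopologicalSpace E] [ContinuousAdd E]
    [ContinuousSMul ℝ E] (hL : IsCompact L) (hLconv : Convex ℝ L)
    (hC : ∀ j b, IsClosed (C j b)) (hCconv : ∀ j b, Convex ℝ (C j b))
    (hcover : ∀ x ∈ L, ∀ j, ∃ b, x ∈ C j b) :
    NoUncountableWellOrderedChain (determinedSets fun p : selectionSpace L C => p.1.2) := by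
  classical
  intro S hchain hwf
  by_contra hS
  -- The initial segment of type `ω₁` of the chain.
  let T := {s ∈ S | {t ∈ S | t < s}.Countable}
  have hT : ¬ T.Countable := by
    intro hT
    have hne : (S \ T).Nonempty := by
      rw [Set.nonempty_iff_ne_empty]
      intro h
      exact hS (hT.mono (Set.sdiff_eq_empty.1 h))
    have hwf' : (S \ T).IsWF := hwf.mono Set.sdiff_subset
    have hmin := hwf'.min_mem hne
    refine hmin.2 ⟨hmin.1, hT.mono ?_⟩
    rintro t ⟨htS, ht⟩
    by_contra htT
    exact hwf'.not_lt_min hne ⟨htS, htT⟩ ht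
  choose F hF using fun s : determinedSets fun p : selectionSpace L C => p.1.2 => s.2
  obtain ⟨T', hT'T, hT', R, hR⟩ := exists_root hT F
  have : Uncountable T' := not_countable_iff.1 fun h => hT' (Set.countable_coe_iff.1 h)
  -- Each member of the chain is the trace of a cylinder of the Cantor cube.
  let W : T' → Set (J → Bool) := fun s =>
    {σ | ∃ p : selectionSpace L C, p ∈ (s.1 : Set _) ∧ ∀ j ∈ F s.1, p.1.2 j = σ j}
  have hmem : ∀ (s : T') (p : selectionSpace L C), p.1.2 ∈ W s ↔ p ∈ (s.1 : Set _) := by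
    intro s p
    constructor
    · rintro ⟨q, hq, hqp⟩
      exact (hF s.1 q p hqp).1 hq
    · exact fun hp => ⟨p, hp, fun _ _ => rfl⟩
  have hlarge : ∀ s : T', ∀ᶠ t in Filter.cocountable, s.1 < (t : T').1 := by
    intro s
    have hc : {t ∈ S | t < s.1}.Countable := (hT'T s.2).2
    have hc' : {t : T' | t.1 ∈ insert s.1 {t ∈ S | t < s.1}}.Countable :=
      (hc.insert _).preimage Subtype.val_injective
    filter_upwards [compl_mem_cocountable hc'] with t ht
    have hne : t.1 ≠ s.1 := fun h => ht (Set.mem_insert_iff.2 (Or.inl h))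
    rcases hchain (hT'T s.2).1 (hT'T t.2).1 hne.symm with h | h
    · exact lt_of_le_of_ne h hne.symm
    · have hlt : t.1 ∈ {t ∈ S | t < s.1} := ⟨(hT'T t.2).1, lt_of_le_of_ne h hne⟩
      exact absurd (Set.mem_insert_iff.2 (Or.inr hlt)) ht
  obtain ⟨γ, hγ⟩ := exists_forall_subset_of_chain (W := W) (F := fun s => F s.1) (R := R)
    hL hLconv hC hCconv hcover
    (fun s σ τ h ⟨p, hp, hpσ⟩ => ⟨p, hp, fun j hj => (hpσ j hj).trans (h j hj)⟩)
    (fun s => by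
      filter_upwards [hlarge s] with t hst p hp hps
      exact (hmem t ⟨p, hp⟩).2 (hst.le ((hmem s ⟨p, hp⟩).1 hps)))
    (fun j hj => by
      have : {t : T' | j ∈ F t.1}.Countable := by
        refine ((hR j hj).preimage Subtype.val_injective).mono fun t ht => ?_
        exact ⟨t.2, ht⟩
      exact compl_mem_cocountable this)
  obtain ⟨δ, hδ⟩ := (hlarge γ).exists
  exact hδ.not_ge fun p hp => (hmem γ p).1 (hγ δ p.1 p.2 ((hmem δ p).2 hp))

/-! ### Obstructions to universality -/

theorem NoUncountableWellOrderedChain.not_strictMono {A : Type u} [BooleanAlgebra A]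
    (hA : NoUncountableWellOrderedChain A) {W : Type*} [LinearOrder W] [WellFoundedLT W]
    [Uncountable W] (g : W → A) : ¬ StrictMono g := by
  intro hg
  have hc : (Set.range g).Countable := by
    refine hA _ ?_ ?_
    · rintro _ ⟨a, rfl⟩ _ ⟨b, rfl⟩ _
      exact (le_total a b).imp (fun h => hg.monotone h) fun h => hg.monotone h
    · refine Set.wellFoundedOn_range.2 ?_
      have : (Function.onFun (· < ·) g : W → W → Prop) = (· < ·) := by
        ext a b
        exact hg.lt_iff_lt
      rw [this]
      exact wellFounded_lt
  exact Set.not_countable_univ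
    (Set.countable_of_injective_of_countable_image (s := Set.univ) hg.injective.injOn
      (by rwa [Set.image_univ]))

theorem setOf_val_subset_iff {K : Type u} {B : BooleanSubalgebra (Set K)} {S T : B} :
    {x : StoneSpace B | x.val S = true} ⊆ {x | x.val T = true} ↔ S ≤ T := by
  constructor
  · intro h k hk
    exact (val_pointUltrafilter B k T).1 (h ((val_pointUltrafilter B k S).2 hk))
  · intro h x hx
    have hsup := x.val_sup S T
    rw [sup_eq_right.2 h] at hsup
    have hx : x.val S = true := hx
    change x.val T = true
    rw [hsup, hx, Bool.true_or]

/-- A Boolean algebra of cardinality at most `κ` containing a chain of order type `ω₁`: the algebra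
generated by the initial segments of `ω₁`. -/
theorem exists_determinedSets_strictMono {κ : Cardinal.{u}} (hκ : ℵ₀ < κ) :
    ∃ (W : Type u) (_ : LinearOrder W) (_ : WellFoundedLT W) (_ : Uncountable W)
      (v : W → W → Bool), #(determinedSets v) ≤ κ ∧
        ∃ g : W → determinedSets v, StrictMono g := by
  let W : Type u := (Cardinal.aleph.{u} 1).ord.ToType
  have hW : #W = ℵ_ 1 := Cardinal.mk_ord_toType _
  have hunc : Uncountable W := by
    rw [← Cardinal.aleph0_lt_mk_iff, hW]
    exact Cardinal.aleph0_lt_aleph_one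
  let v : W → W → Bool := fun x w => decide (x < w)
  refine ⟨W, inferInstance, inferInstance, hunc, v, ?_, ?_⟩
  · refine (mk_determinedSets_le v).trans (max_le ?_ hκ.le)
    rw [hW, ← Cardinal.succ_aleph0]
    exact Order.succ_le_of_lt hκ
  · refine ⟨fun w => ⟨_, setOf_apply_mem_determinedSets v w⟩, fun a b hab => ?_⟩
    refine lt_of_le_not_ge (fun x hx => ?_) fun h => ?_
    · have hx : decide (x < a) = true := hx
      exact decide_eq_true ((of_decide_eq_true hx).trans hab)
    · have : a ∈ {x | v x a = true} := h (show a ∈ {x | v x b = true} from decide_eq_true hab)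
      exact lt_irrefl a (of_decide_eq_true this)

theorem not_isUniversalBooleanAlgebra {κ : Cardinal.{u}} (hκ : ℵ₀ < κ) {A : Type u}
    [BooleanAlgebra A] (hA : NoUncountableWellOrderedChain A) :
    ¬ IsUniversalBooleanAlgebra κ A := by
  rintro ⟨-, hU⟩
  obtain ⟨W, _, _, _, v, hv, g, hg⟩ := exists_determinedSets_strictMono hκ
  obtain ⟨a, b, hab⟩ := exists_pair_ne W
  have : Nontrivial (determinedSets v) := ⟨g a, g b, hg.injective.ne hab⟩
  obtain ⟨h, hinj⟩ := hU (determinedSets v) hv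
  have hmono : StrictMono h :=
    Monotone.strictMono_of_injective (fun S T hST => OrderHomClass.mono h hST) hinj
  exact hA.not_strictMono _ (hmono.comp hg)

theorem not_isUniversalCompactSpace {κ : Cardinal.{u}} (hκ : ℵ₀ < κ) {K : Type u}
    {A : BooleanSubalgebra (Set K)} (hA : NoUncountableWellOrderedChain A) :
    ¬ IsUniversalCompactSpace κ (StoneSpace A) := by
  rintro ⟨-, hU⟩
  obtain ⟨W, _, _, _, v, hv, g, hg⟩ := exists_determinedSets_strictMono hκ
  obtain ⟨w⟩ := (inferInstance : Nonempty W)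
  have : Nonempty (StoneSpace (determinedSets v)) := ⟨pointUltrafilter _ w⟩
  obtain ⟨φ, hφ, hsurj⟩ := hU (StoneSpace (determinedSets v)) (StoneSpace.weight_le.trans hv)
  -- Preimages of clopen sets transport the chain to `A`.
  choose a ha using fun w =>
    StoneSpace.exists_eq_setOf_val ((StoneSpace.isClopen_setOf_val (g w)).preimage hφ)
  have hle : ∀ w w', a w ≤ a w' ↔ g w ≤ g w' := by
    intro w w'
    rw [← setOf_val_subset_iff, ← setOf_val_subset_iff, ← ha, ← ha,
      hsurj.preimage_subset_preimage_iff]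
  refine hA.not_strictMono a fun w w' hww' => ?_
  rw [lt_iff_le_not_ge, hle, hle, ← lt_iff_le_not_ge]
  exact hg hww'

/-! ### The selection space of a dual ball -/

theorem exists_dense_mk_eq_density (X : Type u) [TopologicalSpace X] :
    ∃ D : Set X, Dense D ∧ #D = density X :=
  csInf_mem (s := {c | ∃ D : Set X, Dense D ∧ #D = c}) ⟨_, Set.univ, dense_univ, rfl⟩

section DualBall

variable {X : Type u}

/-- The indices `(d, p, q)`, with `d ∈ D` and rational numbers `p < q`, of the pairs of
overlapping weak* closed half-spaces that separate the functionals. -/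
abbrev ThresholdIndex (D : Set X) : Type u := {j : D × ℚ × ℚ // j.2.1 < j.2.2}

theorem mk_thresholdIndex_le (D : Set X) : #(ThresholdIndex D) ≤ max #D ℵ₀ := by
  refine (Cardinal.mk_subtype_le _).trans ?_
  have h : #(D × ℚ × ℚ) = #D * ℵ₀ := by simp
  rw [h]
  exact Cardinal.mul_le_max_of_aleph0_le_right le_rfl

variable [NormedAddCommGroup X] [NormedSpace ℝ X]

/-- The two half-spaces `{φ | p ≤ φ d}` and `{φ | φ d ≤ q}` attached to the index `(d, p, q)`. -/
def thresholdHalfSpace {D : Set X} (j : ThresholdIndex D) (b : Bool) : Set (WeakDual ℝ X) :=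
  if b = true then {φ | (j.1.2.1 : ℝ) ≤ φ j.1.1} else {φ | φ j.1.1 ≤ (j.1.2.2 : ℝ)}

theorem isClosed_thresholdHalfSpace {D : Set X} (j : ThresholdIndex D) (b : Bool) :
    IsClosed (thresholdHalfSpace j b) := by
  cases b
  · exact isClosed_le (WeakDual.eval_continuous _) continuous_const
  · exact isClosed_le continuous_const (WeakDual.eval_continuous _)

theorem convex_thresholdHalfSpace {D : Set X} (j : ThresholdIndex D) (b : Bool) :
    Convex ℝ (thresholdHalfSpace j b) := by
  have h : IsLinearMap ℝ fun φ : WeakDual ℝ X => φ j.1.1 := ⟨fun _ _ => rfl, fun _ _ => rfl⟩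
  cases b
  · exact convex_halfSpace_le h _
  · exact convex_halfSpace_ge h _

theorem exists_mem_thresholdHalfSpace {D : Set X} (φ : WeakDual ℝ X) (j : ThresholdIndex D) :
    ∃ b, φ ∈ thresholdHalfSpace j b := by
  rcases le_total (j.1.2.1 : ℝ) (φ j.1.1) with h | h
  · exact ⟨true, h⟩
  · exact ⟨false, h.trans (by exact_mod_cast j.2.le)⟩

/-- A selection determines the functional below it, as the half-spaces separate functionals. -/
theorem injective_selection {D : Set X} (hD : Dense D) (L : Set (WeakDual ℝ X)) :
    Function.Injective fun p : selectionSpace L (thresholdHalfSpace (D := D)) => p.1.2 := by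
  have key : ∀ p q : selectionSpace L (thresholdHalfSpace (D := D)), p.1.2 = q.1.2 →
      ∀ d ∈ D, p.1.1 d ≤ q.1.1 d := by
    intro p q h d hd
    by_contra! hlt
    obtain ⟨r, hr1, hr2⟩ := exists_rat_btwn hlt
    obtain ⟨s, hs1, hs2⟩ := exists_rat_btwn hr2
    let j : ThresholdIndex D := ⟨(⟨d, hd⟩, r, s), by exact_mod_cast hs1⟩
    have hp := p.2.2 j
    have hq := q.2.2 j
    rw [← h] at hq
    cases hb : p.1.2 j <;> rw [hb] at hp hq
    · exact (lt_of_lt_of_le hs2 hp).false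
    · exact (lt_of_le_of_lt hq hr1).false
  intro p q h
  have h1 : p.1.1 = q.1.1 := by
    have := Continuous.ext_on hD (WeakDual.toStrongDual p.1.1).continuous
      (WeakDual.toStrongDual q.1.1).continuous fun d hd =>
        (key p q h d hd).antisymm (key q p h.symm d hd)
    exact DFunLike.coe_injective this
  exact Subtype.ext (Prod.ext h1 h)

/-- The algebra attached to `X`: its Stone space is the selection space of the dual ball, which maps
onto the dual ball. -/
theorem exists_determinedSets_linearIsometry {κ : Cardinal.{u}} (hκ : ℵ₀ ≤ κ)
    (hX : density X ≤ κ) :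
    ∃ (K J : Type u) (v : K → J → Bool), #J ≤ κ ∧
      NoUncountableWellOrderedChain (determinedSets v) ∧
      Nonempty (X →ₗᵢ[ℝ] C(StoneSpace (determinedSets v), ℝ)) := by
  obtain ⟨D, hD, hDX⟩ := exists_dense_mk_eq_density X
  let L : Set (WeakDual ℝ X) := WeakDual.toStrongDual ⁻¹' Metric.closedBall 0 1
  have hL : IsCompact L := WeakDual.isCompact_closedBall 0 1
  have hLconv : Convex ℝ L :=
    (convex_closedBall (0 : StrongDual ℝ X) 1).linear_preimage
      (WeakDual.toStrongDual (𝕜 := ℝ) (E := X)).toLinearMap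
  let K := selectionSpace L (thresholdHalfSpace (D := D))
  have : CompactSpace K := isCompact_iff_compactSpace.1
    (isCompact_selectionSpace hL isClosed_thresholdHalfSpace)
  let v : K → ThresholdIndex D → Bool := fun p => p.1.2
  refine ⟨K, ThresholdIndex D, v, ?_, ?_, ?_⟩
  · exact (mk_thresholdIndex_le D).trans (max_le (hDX.trans_le hX) hκ)
  · exact noUncountableWellOrderedChain_selectionSpace hL hLconv isClosed_thresholdHalfSpace
      convex_thresholdHalfSpace fun x _ => exists_mem_thresholdHalfSpace x
  · obtain ⟨e⟩ := exists_homeomorph_stoneSpace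
      (show Continuous v from continuous_snd.comp continuous_subtype_val)
      (injective_selection hD L)
    refine ⟨⟨{ toFun := fun x => ⟨fun s => (e s).1.1 x, ?_⟩, map_add' := ?_, map_smul' := ?_ }, ?_⟩⟩
    · exact (WeakDual.eval_continuous x).comp
        (continuous_fst.comp (continuous_subtype_val.comp e.continuous))
    · intro x y
      ext s
      exact map_add (e s).1.1 x y
    · intro c x
      ext s
      exact map_smul (e s).1.1 c x
    · intro x
      refine le_antisymm ((ContinuousMap.norm_le _ (norm_nonneg x)).2 fun s => ?_) ?_
      · have h : ‖WeakDual.toStrongDual (e s).1.1‖ ≤ 1 := mem_closedBall_zero_iff.1 (e s).2.1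
        exact (WeakDual.toStrongDual (e s).1.1).le_of_opNorm_le_of_le h le_rfl |>.trans_eq
          (one_mul _)
      · obtain ⟨φ, hφ, hφx⟩ := exists_dual_vector'' ℝ x
        choose σ hσ using fun j =>
          exists_mem_thresholdHalfSpace (D := D) (StrongDual.toWeakDual φ) j
        let k : K := ⟨(StrongDual.toWeakDual φ, σ), mem_closedBall_zero_iff.2 hφ, hσ⟩
        refine le_trans ?_ (ContinuousMap.norm_coe_le_norm _ (e.symm k))
        change ‖x‖ ≤ ‖(e (e.symm k)).1.1 x‖
        rw [e.apply_symm_apply]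
        change ‖x‖ ≤ ‖φ x‖
        rw [hφx]
        simp

end DualBall

end UnivBanach

theorem mainTheorem1 (κ : Cardinal.{u}) (hκ : Cardinal.aleph0 < κ)
    (hX : ∃ (X : Type u) (_ : NormedAddCommGroup X) (_ : NormedSpace ℝ X) (_ : CompleteSpace X),
      UnivBanach.IsUniversalBanachSpace κ X) :
    ∃ (A : Type u) (_ : BooleanAlgebra A),
      UnivBanach.IsUniversalBanachSpace κ C(UnivBanach.StoneSpace A, ℝ) ∧
      UnivBanach.NoUncountableWellOrderedChain A ∧
      Cardinal.mk A ≤ κ ∧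
      UnivBanach.weight (UnivBanach.StoneSpace A) ≤ κ ∧
      ¬ UnivBanach.IsUniversalBooleanAlgebra κ A ∧
      ¬ UnivBanach.IsUniversalCompactSpace κ (UnivBanach.StoneSpace A) := by
  obtain ⟨X, _, _, _, hdens, huniv⟩ := hX
  obtain ⟨K, J, v, hJ, hchain, ⟨f⟩⟩ :=
    UnivBanach.exists_determinedSets_linearIsometry hκ.le hdens
  have hcard : #(UnivBanach.determinedSets v) ≤ κ :=
    (UnivBanach.mk_determinedSets_le v).trans (max_le hJ hκ.le)
  refine ⟨UnivBanach.determinedSets v, inferInstance, ⟨?_, ?_⟩, hchain, hcard,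
    UnivBanach.StoneSpace.weight_le.trans hcard,
    UnivBanach.not_isUniversalBooleanAlgebra hκ hchain,
    UnivBanach.not_isUniversalCompactSpace hκ hchain⟩
  · exact UnivBanach.StoneSpace.density_continuousMap_le.trans (max_le hcard hκ.le)
  · intro Y _ _ _ hY
    obtain ⟨g⟩ := huniv Y hY
    exact ⟨f.comp g⟩
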